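/- **Notation.** For $\sigma=(\sigma_1,\dots,\sigma_D)$ with $\sigma_i\ge 0$ and mean $\bar\sigma=\frac1D\sum_i\sigma_i$, put $\mathrm{CV}^2(\sigma)=\frac1D\sum_i(\sigma_i-\bar\sigma)^2/\bar\sigma^2$. In the per-coordinate model let $Z_1,\dots,Z_D$ be independent with $Z_i\sim\mathcal N(0,\sigma_i^2)$, let $\alpha=\sqrt{2/\pi}\,\bar\sigma$ be the magnitude threshold, and let $\rho_1(\sigma)$ and $\rho_2(\sigma)$ be the Pearson correlations of $\sum_i Z_i$ with the 1-bit score $\sum_i\operatorname{sign}(Z_i)$ and with the 2-bit score $\sum_i(1+\mathbf 1[|Z_i|>\alpha])\operatorname{sign}(Z_i)$, respectively. Write $\mathbf 1_D$ for the all-ones vector of $\mathbb R^D$. The 2-bit advantage is decomposed as $$\Delta\rho(\sigma):=\rho_2(\sigma)-\rho_1(\sigma)=\Delta_0+\Delta_{\mathrm{het}}(\sigma),\qquad \Delta_0:=\rho_2(\bar\sigma\mathbf 1_D)-\rho_1(\bar\sigma\mathbf 1_D).$$ **Corollary (rotation harms heterogeneity-aware BQ).** The isotropic gain $\Delta_0$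 is a strictly positive universal constant: it has the same value for all $D\ge1$ and all $\sigma\in\mathbb R_{\ge0}^D$ with $\bar\sigma>0$. Let $(\Sigma_k)_k$ be any sequence of real symmetric positive semidefinite matrices, $\Sigma_k$ of size $D_k\times D_k$, satisfying the effective-rank condition $$\frac{\operatorname{tr}(\Sigma_k)}{\|\Sigma_k\|_{\mathrm{op}}}\longrightarrow\infty ,$$ let $Q_k$ be a Haar-random orthogonal $D_k\times D_k$ matrix with rows $q_1^\top,\dots,q_{D_k}^\top$, and let $\tilde\sigma^{(k)}_i=\sqrt{q_i^\top\Sigma_k q_i}$ be the coordinate standard deviations after rotation. Then, as $k\to\infty$, in probability, $$\mathrm{CV}^2(\tilde\sigma^{(k)})\to0,\qquad \Delta_{\mathrm{het}}(\tilde\sigma^{(k)})\to0,\qquad \Delta\rho(\tilde\sigma^{(k)})\to\Delta_0>0 .$$ That is, rotation eliminates the heterogeneity-dependent part of the 2-bit advantage, while the isotropic gain survives. -/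

import Mathlib

open MeasureTheory ProbabilityTheory Filter Topology

noncomputable section

namespace BQ

/-! ### Haar measure on the orthogonal group -/

/-- The real orthogonal group `O(D)`, with the topology induced from `D × D` matrices. -/
abbrev Orth (D : ℕ) : Type := ↥(Matrix.orthogonalGroup (Fin D) ℝ)

instance instCompactSpaceOrth (D : ℕ) : CompactSpace (Orth D) := by
  refine isCompact_iff_compactSpace.mp
    (?_ : IsCompact (Matrix.orthogonalGroup (Fin D) ℝ : Set (Matrix (Fin D) (Fin D) ℝ)))
  have hbox : IsCompact {A : Matrix (Fin D) (Fin D) ℝ | ∀ i j, A i j ∈ Set.Icc (-1 : ℝ) 1} := by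
    have h := isCompact_univ_pi (X := fun _ : Fin D => Fin D → ℝ)
      (s := fun _ => Set.univ.pi fun _ => Set.Icc (-1 : ℝ) 1)
      (fun _ => isCompact_univ_pi fun _ => isCompact_Icc)
    have heq : {A : Matrix (Fin D) (Fin D) ℝ | ∀ i j, A i j ∈ Set.Icc (-1 : ℝ) 1}
        = Set.univ.pi fun _ : Fin D => Set.univ.pi fun _ : Fin D => Set.Icc (-1 : ℝ) 1 :=
      Set.ext fun A => ⟨fun hA i _ j _ => hA i j, fun hA i j => hA i trivial j trivial⟩
    rw [heq]
    exact h
  refine hbox.of_isClosed_subset ?_ ?_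
  · have hc : Continuous fun A : Matrix (Fin D) (Fin D) ℝ => A * star A := by fun_prop
    have heq : (Matrix.orthogonalGroup (Fin D) ℝ : Set (Matrix (Fin D) (Fin D) ℝ))
        = (fun A : Matrix (Fin D) (Fin D) ℝ => A * star A) ⁻¹' {1} := by
      ext A
      exact Matrix.mem_unitaryGroup_iff
    rw [heq]
    exact isClosed_singleton.preimage hc
  · intro A hA i j
    have h := entry_norm_bound_of_unitary (𝕜 := ℝ) hA i j
    rw [Real.norm_eq_abs] at h
    exact abs_le.mp h

instance instMeasurableSpaceOrth (D : ℕ) : MeasurableSpace (Orth D) := borel _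

instance instBorelSpaceOrth (D : ℕ) : BorelSpace (Orth D) := ⟨rfl⟩

/-- The law of a Haar-random orthogonal matrix: the Haar measure of `O(D)` of total mass `1`. -/
def haarOrth (D : ℕ) : Measure (Orth D) := Measure.haarMeasure ⊤

instance instIsProbabilityMeasureHaarOrth (D : ℕ) : IsProbabilityMeasure (haarOrth D) :=
  ⟨by
    have h := Measure.haarMeasure_self (G := Orth D) (K₀ := ⊤)
    rwa [TopologicalSpace.PositiveCompacts.coe_top] at h⟩

/-! ### Covariances, effective rank, rotated standard deviations -/

/-- The effective rank `tr S / ‖S‖_op`; the norm is the operator norm on Euclidean space. -/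
def effRank {D : ℕ} (S : Matrix (Fin D) (Fin D) ℝ) : ℝ :=
  S.trace / ‖Matrix.toEuclideanCLM (n := Fin D) (𝕜 := ℝ) S‖

/-- The coordinate standard deviations after rotation by `Q`: the square roots of the diagonal
entries `qᵢᵀ S qᵢ` of `Q S Qᵀ`, where `qᵢᵀ` is the `i`-th row of `Q`. -/
def rotatedStd {D : ℕ} (S : Matrix (Fin D) (Fin D) ℝ) (Q : Orth D) (i : Fin D) : ℝ :=
  Real.sqrt ((Q.1 * S * Q.1.transpose) i i)

/-- The mean of the entries of `σ`. -/
def mean {D : ℕ} (σ : Fin D → ℝ) : ℝ := (∑ i, σ i) / D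

/-- The squared coefficient of variation of the entries of `σ`. -/
def cvSq {D : ℕ} (σ : Fin D → ℝ) : ℝ :=
  ((∑ i, (σ i - mean σ) ^ 2) / D) / mean σ ^ 2

/-! ### The per-coordinate model -/

/-- Independent centred Gaussian coordinates with standard deviations `σ i`. -/
def model {D : ℕ} (σ : Fin D → ℝ) : Measure (Fin D → ℝ) :=
  Measure.pi fun i => gaussianReal 0 (Real.toNNReal (σ i ^ 2))

/-- The magnitude threshold: for `σ ≥ 0` this is `(1/D) ∑ i, E|z i|` in the model. -/
def threshold {D : ℕ} (σ : Fin D → ℝ) : ℝ := Real.sqrt (2 / Real.pi) * mean σ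

open Classical in
/-- The magnitude bit with threshold `α`. -/
def magBit (α t : ℝ) : ℝ := if α < |t| then 1 else 0

/-- One-bit score with uniform weights. -/
def score1 {D : ℕ} (z : Fin D → ℝ) : ℝ := ∑ i, Real.sign (z i)

/-- Two-bit score with uniform weights and magnitude threshold `α`. -/
def score2 {D : ℕ} (α : ℝ) (z : Fin D → ℝ) : ℝ :=
  ∑ i, (1 + magBit α (z i)) * Real.sign (z i)

/-- The unquantized score with uniform weights. -/
def score {D : ℕ} (z : Fin D → ℝ) : ℝ := ∑ i, z i

/-- Pearson correlation. -/
def corr {Ω : Type*} [MeasurableSpace Ω] (X Y : Ω → ℝ) (μ : Measure Ω) : ℝ :=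
  covariance X Y μ / Real.sqrt (variance X μ * variance Y μ)

/-- Fidelity of the one-bit score. -/
def rho1 {D : ℕ} (σ : Fin D → ℝ) : ℝ := corr score1 score (model σ)

/-- Fidelity of the two-bit score. -/
def rho2 {D : ℕ} (σ : Fin D → ℝ) : ℝ := corr (score2 (threshold σ)) score (model σ)

/-- The two-bit advantage `Δρ(σ)`. -/
def advantage {D : ℕ} (σ : Fin D → ℝ) : ℝ := rho2 σ - rho1 σ

/-- The isotropic gain: the two-bit advantage when every standard deviation is replaced by
the mean one. -/
def isoGain {D : ℕ} (σ : Fin D → ℝ) : ℝ :=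
  rho2 (fun _ : Fin D => mean σ) - rho1 (fun _ : Fin D => mean σ)

/-- The heterogeneity term `Δ_het(σ) = Δρ(σ) - Δ₀`. -/
def hetGain {D : ℕ} (σ : Fin D → ℝ) : ℝ := advantage σ - isoGain σ

/-- Convergence to `0` in probability of real random variables `X k` on `O(d k)`. -/
def TendstoZeroInProb {d : ℕ → ℕ} (X : ∀ k, Orth (d k) → ℝ) : Prop :=
  ∀ ε : ℝ, 0 < ε → Tendsto (fun k => haarOrth (d k) {Q | ε ≤ |X k Q|}) atTop (𝓝 0)

end BQ

end

/-!
Let `x` be the diagonal of `Q S Qᵀ` and `m` the mean of the standard deviations `σ = √x`.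
Multiplying `Q` by the orthogonal matrix that sends `eᵢ, eⱼ` to `(eᵢ ± eⱼ) / √2` turns
`(xᵢ - xⱼ) / 2` into the entry `(i, j)`, so under Haar measure `E (xᵢ - xⱼ)²` is four times the
mean square of that entry. Since `∑ᵢ xᵢ = tr S` and `∑ᵢⱼ (Q S Qᵀ)ᵢⱼ² = tr S²` do not depend on `Q`,
this gives `E CV²(x) ≤ 2 tr S² / (tr S)² ≤ 2 ‖S‖ / tr S`. Square roots do not increase the
coefficient of variation, because `(∑ σ²)³ ≤ (∑ σ)² ∑ σ⁴`, so `CV²(σ)` tends to `0` in probability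
by Markov's inequality.

In units of `m` the threshold is a constant, and the correlations become functions of averages of
`φ (σᵢ / m)`, where `φ` is a Gaussian moment: continuous at `1` and of at most quadratic growth.
Hence `|average - φ 1| ≤ ε + K CV²(σ)` uniformly in the dimension, and the correlations converge to
their isotropic values. The isotropic gain is computed from the moments of the two-bit quantizer.
-/

namespace BQ

/-! ### The coefficient of variation -/

section CoefficientOfVariation

lemma sum_sum_sub_sq {ι R : Type*} [Fintype ι] [CommRing R] (x : ι → R) :
    ∑ i, ∑ j, (x i - x j) ^ 2 = 2 * (Fintype.card ι * ∑ i, x i ^ 2 - (∑ i, x i) ^ 2) := by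
  simp only [sub_sq, Finset.sum_add_distrib, Finset.sum_sub_distrib, ← Finset.sum_mul,
    ← Finset.mul_sum, Finset.sum_const, Finset.card_univ, nsmul_eq_mul]
  ring

variable {D : ℕ}

lemma dim_pos_of_mean_pos {σ : Fin D → ℝ} (h : 0 < mean σ) : 0 < D := by
  rcases D.eq_zero_or_pos with rfl | hD
  · simp [mean] at h
  · exact hD

lemma mean_const (hD : 0 < D) (m : ℝ) : mean (fun _ : Fin D => m) = m := by
  simp [mean, hD.ne']

lemma cvSq_nonneg (σ : Fin D → ℝ) : 0 ≤ cvSq σ := by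
  unfold cvSq
  positivity

lemma cvSq_eq_sum_sum (σ : Fin D → ℝ) :
    cvSq σ = (∑ i, ∑ j, (σ i - σ j) ^ 2) / (2 * (∑ i, σ i) ^ 2) := by
  rcases D.eq_zero_or_pos with rfl | hD
  · simp [cvSq]
  rw [sum_sum_sub_sq, Fintype.card_fin]
  simp only [cvSq, mean, sub_sq, Finset.sum_add_distrib, Finset.sum_sub_distrib, ← Finset.sum_mul,
    ← Finset.mul_sum, Finset.sum_const, Finset.card_univ, Fintype.card_fin, nsmul_eq_mul]
  field_simp
  ring

lemma cvSq_eq_sub_one {σ : Fin D → ℝ} (h : ∑ i, σ i ≠ 0) :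
    cvSq σ = D * (∑ i, σ i ^ 2) / (∑ i, σ i) ^ 2 - 1 := by
  rw [cvSq_eq_sum_sum, sum_sum_sub_sq, Fintype.card_fin]
  field_simp

/-- Log-convexity of power sums: with `s = √x`, two applications of Cauchy-Schwarz bound
`(∑ s²)³` by `(∑ s)² ∑ s⁴`. -/
lemma sum_pow_three_le_sum_sqrt_sq_mul {ι : Type*} (t : Finset ι) {x : ι → ℝ}
    (hx : ∀ i ∈ t, 0 ≤ x i) :
    (∑ i ∈ t, x i) ^ 3 ≤ (∑ i ∈ t, √(x i)) ^ 2 * ∑ i ∈ t, x i ^ 2 := by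
  have hsqrt : ∀ i ∈ t, x i ^ 2 ≤ √(x i) * (√(x i) * x i) := fun i hi => by
    rw [← mul_assoc, Real.mul_self_sqrt (hx i hi), sq]
  have hcube : ∀ i ∈ t, (√(x i) * x i) ^ 2 ≤ x i * x i ^ 2 := fun i hi => by
    rw [mul_pow, Real.sq_sqrt (hx i hi)]
  have h₁ := Finset.sum_sq_le_sum_mul_sum_of_sq_le_mul t
    (fun i _ => Real.sqrt_nonneg (x i))
    (fun i hi => mul_nonneg (Real.sqrt_nonneg (x i)) (hx i hi)) hsqrt
  have h₂ := Finset.sum_sq_le_sum_mul_sum_of_sq_le_mul t hx (fun i _ => sq_nonneg (x i)) hcube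
  rcases (Finset.sum_nonneg hx).eq_or_lt with h₀ | h₀
  · rw [← h₀, zero_pow three_ne_zero]
    exact mul_nonneg (sq_nonneg _) (Finset.sum_nonneg fun i _ => sq_nonneg _)
  refine le_of_mul_le_mul_right ?_ h₀
  calc (∑ i ∈ t, x i) ^ 3 * ∑ i ∈ t, x i = ((∑ i ∈ t, x i) ^ 2) ^ 2 := by ring
    _ ≤ ((∑ i ∈ t, √(x i)) * ∑ i ∈ t, √(x i) * x i) ^ 2 := by gcongr
    _ = (∑ i ∈ t, √(x i)) ^ 2 * (∑ i ∈ t, √(x i) * x i) ^ 2 := by ring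
    _ ≤ (∑ i ∈ t, √(x i)) ^ 2 * ((∑ i ∈ t, x i) * ∑ i ∈ t, x i ^ 2) := by gcongr
    _ = (∑ i ∈ t, √(x i)) ^ 2 * (∑ i ∈ t, x i ^ 2) * ∑ i ∈ t, x i := by ring

lemma mean_sqrt_pos {x : Fin D → ℝ} (hx : 0 < mean x) : 0 < mean fun i => √(x i) := by
  have hD : (0 : ℝ) < D := by exact_mod_cast dim_pos_of_mean_pos hx
  obtain ⟨i, -, hi⟩ := Finset.exists_lt_of_sum_lt (s := Finset.univ) (f := fun _ => 0) (g := x)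
    (by simpa using (div_pos_iff_of_pos_right hD).1 hx)
  exact div_pos (Finset.sum_pos' (fun j _ => Real.sqrt_nonneg _)
    ⟨i, Finset.mem_univ i, Real.sqrt_pos.2 hi⟩) hD

lemma cvSq_sqrt_le {x : Fin D → ℝ} (hx : ∀ i, 0 ≤ x i) : cvSq (fun i => √(x i)) ≤ cvSq x := by
  rcases eq_or_ne (∑ i, √(x i)) 0 with h₀ | h₀
  · rw [cvSq_eq_sum_sum, h₀]
    simpa using cvSq_nonneg x
  have hsum : 0 < ∑ i, x i := by
    obtain ⟨i, -, hi⟩ := Finset.exists_ne_zero_of_sum_ne_zero h₀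
    have hxi : 0 < x i := Real.sqrt_pos.1 ((Real.sqrt_nonneg _).lt_of_ne' hi)
    exact Finset.sum_pos' (fun j _ => hx j) ⟨i, Finset.mem_univ i, hxi⟩
  have hpow := sum_pow_three_le_sum_sqrt_sq_mul Finset.univ fun i _ => hx i
  rw [cvSq_eq_sub_one h₀, cvSq_eq_sub_one hsum.ne', sub_le_sub_iff_right,
    div_le_div_iff₀ (by positivity) (by positivity)]
  simp only [Real.sq_sqrt (hx _)]
  calc D * (∑ i, x i) * (∑ i, x i) ^ 2 = D * (∑ i, x i) ^ 3 := by ring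
    _ ≤ D * ((∑ i, √(x i)) ^ 2 * ∑ i, x i ^ 2) := by gcongr
    _ = D * (∑ i, x i ^ 2) * (∑ i, √(x i)) ^ 2 := by ring

end CoefficientOfVariation

/-! ### Second moments of a Haar-rotated matrix -/

section HaarMoments

open Matrix

section MixMatrix

variable {n : Type*} [Fintype n] [DecidableEq n]

/-- The rows of `mixMatrix`, the two mixed ones being those of index `i` and `j`. -/
noncomputable def mixRow (i j a : n) : n → ℝ :=
  if a = i then √(1 / 2) • (Pi.single i 1 + Pi.single j 1)
  else if a = j then √(1 / 2) • (Pi.single i 1 - Pi.single j 1)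
  else Pi.single a 1

/-- The matrix that replaces the basis vectors `eᵢ, eⱼ` by `(eᵢ + eⱼ) / √2, (eᵢ - eⱼ) / √2`. It
turns the difference of two diagonal entries into an off-diagonal one. -/
noncomputable def mixMatrix (i j : n) : Matrix n n ℝ := Matrix.of (mixRow i j)

lemma mixMatrix_mem_orthogonalGroup {i j : n} (hij : i ≠ j) :
    mixMatrix i j ∈ Matrix.orthogonalGroup n ℝ := by
  rw [Matrix.mem_orthogonalGroup_iff]
  have hhalf : √(1 / 2 : ℝ) * √(1 / 2) = 1 / 2 := Real.mul_self_sqrt (by norm_num)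
  have hdot (a b : n) : (mixMatrix i j * (mixMatrix i j)ᵀ) a b = mixRow i j a ⬝ᵥ mixRow i j b := rfl
  ext a b
  rw [hdot, Matrix.one_apply]
  unfold mixRow
  split_ifs <;> simp_all [dotProduct_smul] <;> grind

lemma mixMatrix_mul_mul_transpose_apply {i j : n} (hij : i ≠ j) {A : Matrix n n ℝ}
    (hA : A.IsSymm) :
    (mixMatrix i j * A * (mixMatrix i j)ᵀ) i j = (A i i - A j j) / 2 := by
  have hhalf : √(1 / 2 : ℝ) * √(1 / 2) = 1 / 2 := Real.mul_self_sqrt (by norm_num)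
  have hdot : (mixMatrix i j * A * (mixMatrix i j)ᵀ) i j =
      (mixRow i j i ᵥ* A) ⬝ᵥ mixRow i j j := rfl
  rw [hdot, ← dotProduct_mulVec]
  simp only [mixRow, hij.symm, if_true, if_false, smul_dotProduct, mulVec_smul, dotProduct_smul,
    mulVec_sub, add_dotProduct, dotProduct_sub, mulVec_single_one, single_one_dotProduct,
    smul_eq_mul, col_apply]
  linear_combination (A i i - A j j) * hhalf + √(1 / 2) * √(1 / 2) * hA.apply i j

end MixMatrix

section OpNorm

variable {n : Type*} [Fintype n] [DecidableEq n]

lemma dotProduct_mulVec_le_opNorm (A : Matrix n n ℝ) (v : n → ℝ) :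
    v ⬝ᵥ A *ᵥ v ≤ ‖Matrix.toEuclideanCLM (n := n) (𝕜 := ℝ) A‖ * (v ⬝ᵥ v) := by
  set T := Matrix.toEuclideanCLM (n := n) (𝕜 := ℝ) A
  have hnorm : ‖WithLp.toLp 2 v‖ * ‖WithLp.toLp 2 v‖ = v ⬝ᵥ v := by
    rw [← real_inner_self_eq_norm_mul_norm, EuclideanSpace.inner_toLp_toLp, star_trivial]
  calc v ⬝ᵥ A *ᵥ v = inner ℝ (WithLp.toLp 2 v) (T (WithLp.toLp 2 v)) :=
        (Matrix.inner_toEuclideanCLM ..).symm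
    _ ≤ ‖WithLp.toLp 2 v‖ * ‖T (WithLp.toLp 2 v)‖ := real_inner_le_norm _ _
    _ ≤ ‖WithLp.toLp 2 v‖ * (‖T‖ * ‖WithLp.toLp 2 v‖) := by gcongr; exact T.le_opNorm _
    _ = ‖T‖ * (v ⬝ᵥ v) := by rw [← hnorm]; ring

lemma trace_mul_le_opNorm_mul_trace (A : Matrix n n ℝ) {S : Matrix n n ℝ} (hS : S.PosSemidef) :
    (A * S).trace ≤ ‖Matrix.toEuclideanCLM (n := n) (𝕜 := ℝ) A‖ * S.trace := by
  obtain ⟨B, rfl⟩ : ∃ B : Matrix n n ℝ, S = Bᵀ * B := by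
    open scoped MatrixOrder in
    exact CStarAlgebra.nonneg_iff_eq_star_mul_self.mp hS.nonneg
  have hleft : (A * (Bᵀ * B)).trace = ∑ k, B k ⬝ᵥ A *ᵥ B k := by
    rw [← Matrix.mul_assoc, Matrix.trace_mul_comm]
    rfl
  have hright : (Bᵀ * B).trace = ∑ k, B k ⬝ᵥ B k := by
    rw [Matrix.trace_mul_comm]
    rfl
  rw [hleft, hright, Finset.mul_sum]
  exact Finset.sum_le_sum fun k _ => dotProduct_mulVec_le_opNorm A (B k)

end OpNorm

variable {D : ℕ}

/-- The covariance matrix `Q S Qᵀ` after rotation by `Q`; the entries of `rotatedStd S Q` are the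
square roots of its diagonal entries. -/
def rotatedCov (S : Matrix (Fin D) (Fin D) ℝ) (Q : Orth D) : Matrix (Fin D) (Fin D) ℝ :=
  Q.1 * S * Q.1ᵀ

@[fun_prop]
lemma continuous_rotatedCov (S : Matrix (Fin D) (Fin D) ℝ) : Continuous (rotatedCov S) := by
  unfold rotatedCov
  fun_prop

lemma rotatedCov_mul (S : Matrix (Fin D) (Fin D) ℝ) (G Q : Orth D) :
    rotatedCov S (G * Q) = G.1 * rotatedCov S Q * G.1ᵀ := by
  simp [rotatedCov, Matrix.transpose_mul, Matrix.mul_assoc]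

lemma isSymm_rotatedCov {S : Matrix (Fin D) (Fin D) ℝ} (hS : S.IsSymm) (Q : Orth D) :
    (rotatedCov S Q).IsSymm := by
  rw [rotatedCov, Matrix.IsSymm, Matrix.transpose_mul, Matrix.transpose_mul,
    Matrix.transpose_transpose, hS.eq, Matrix.mul_assoc]

lemma posSemidef_rotatedCov {S : Matrix (Fin D) (Fin D) ℝ} (hS : S.PosSemidef) (Q : Orth D) :
    (rotatedCov S Q).PosSemidef := by
  simpa [rotatedCov] using hS.mul_mul_conjTranspose_same Q.1

lemma transpose_mul_self_orth (Q : Orth D) : Q.1ᵀ * Q.1 = 1 :=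
  (Matrix.mem_orthogonalGroup_iff' (Fin D) ℝ).1 Q.2

lemma trace_rotatedCov (S : Matrix (Fin D) (Fin D) ℝ) (Q : Orth D) :
    (rotatedCov S Q).trace = S.trace := by
  rw [rotatedCov, Matrix.trace_mul_comm, ← Matrix.mul_assoc, transpose_mul_self_orth,
    Matrix.one_mul]

lemma sum_diag_rotatedCov (S : Matrix (Fin D) (Fin D) ℝ) (Q : Orth D) :
    ∑ i, (rotatedCov S Q).diag i = S.trace :=
  trace_rotatedCov S Q

lemma cvSq_diag_rotatedCov (S : Matrix (Fin D) (Fin D) ℝ) (Q : Orth D) :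
    cvSq (rotatedCov S Q).diag
      = (∑ i, ∑ j, (rotatedCov S Q i i - rotatedCov S Q j j) ^ 2) / (2 * S.trace ^ 2) := by
  rw [cvSq_eq_sum_sum, sum_diag_rotatedCov]
  rfl

lemma rotatedCov_mul_transpose (S : Matrix (Fin D) (Fin D) ℝ) (Q : Orth D) :
    rotatedCov S Q * (rotatedCov S Q)ᵀ = rotatedCov (S * Sᵀ) Q := by
  simp only [rotatedCov, Matrix.transpose_mul, Matrix.transpose_transpose, Matrix.mul_assoc]
  rw [← Matrix.mul_assoc Q.1ᵀ Q.1, transpose_mul_self_orth, Matrix.one_mul]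

lemma sum_sq_rotatedCov (S : Matrix (Fin D) (Fin D) ℝ) (Q : Orth D) :
    ∑ i, ∑ j, rotatedCov S Q i j ^ 2 = (S * Sᵀ).trace := by
  rw [← trace_rotatedCov (S * Sᵀ) Q, ← rotatedCov_mul_transpose]
  simp only [Matrix.trace, Matrix.diag, Matrix.mul_apply, Matrix.transpose_apply, sq]

instance : (haarOrth D).IsMulLeftInvariant := by unfold haarOrth; infer_instance

lemma integrable_haarOrth {f : Orth D → ℝ} (hf : Continuous f) : Integrable f (haarOrth D) :=
  hf.integrable_of_hasCompactSupport (HasCompactSupport.of_compactSpace f)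

lemma integral_sq_diag_rotatedCov_sub {S : Matrix (Fin D) (Fin D) ℝ} (hS : S.IsSymm)
    {i j : Fin D} (hij : i ≠ j) :
    ∫ Q, (rotatedCov S Q i i - rotatedCov S Q j j) ^ 2 ∂haarOrth D
      = 4 * ∫ Q, rotatedCov S Q i j ^ 2 ∂haarOrth D := by
  let G : Orth D := ⟨mixMatrix i j, mixMatrix_mem_orthogonalGroup hij⟩
  rw [← integral_mul_left_eq_self (fun Q => rotatedCov S Q i j ^ 2) G, ← integral_const_mul]
  refine integral_congr_ae (.of_forall fun Q => ?_)
  simp only [rotatedCov_mul, G, mixMatrix_mul_mul_transpose_apply hij (isSymm_rotatedCov hS Q)]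
  ring

lemma integral_cvSq_diag_rotatedCov_le {S : Matrix (Fin D) (Fin D) ℝ} (hS : S.IsSymm) :
    ∫ Q, cvSq (rotatedCov S Q).diag ∂haarOrth D ≤ 2 * (S * Sᵀ).trace / S.trace ^ 2 := by
  have hentry (i j : Fin D) :
      ∫ Q, (rotatedCov S Q i i - rotatedCov S Q j j) ^ 2 ∂haarOrth D
        ≤ 4 * ∫ Q, rotatedCov S Q i j ^ 2 ∂haarOrth D := by
    rcases eq_or_ne i j with rfl | hij
    · simpa using integral_nonneg fun Q => sq_nonneg (rotatedCov S Q i i)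
    · exact (integral_sq_diag_rotatedCov_sub hS hij).le
  have hsum : ∫ Q, ∑ i, ∑ j, (rotatedCov S Q i i - rotatedCov S Q j j) ^ 2 ∂haarOrth D
      ≤ 4 * ∫ Q, ∑ i, ∑ j, rotatedCov S Q i j ^ 2 ∂haarOrth D := by
    rw [integral_finsetSum _ fun i _ => integrable_haarOrth (by fun_prop),
      integral_finsetSum _ fun i _ => integrable_haarOrth (by fun_prop), Finset.mul_sum]
    refine Finset.sum_le_sum fun i _ => ?_
    rw [integral_finsetSum _ fun j _ => integrable_haarOrth (by fun_prop),
      integral_finsetSum _ fun j _ => integrable_haarOrth (by fun_prop), Finset.mul_sum]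
    exact Finset.sum_le_sum fun j _ => hentry i j
  simp only [sum_sq_rotatedCov, integral_const, probReal_univ, one_smul] at hsum
  simp only [cvSq_diag_rotatedCov, integral_div]
  calc _ ≤ 4 * (S * Sᵀ).trace / (2 * S.trace ^ 2) := by gcongr
    _ = 2 * (S * Sᵀ).trace / S.trace ^ 2 := by ring

lemma integral_cvSq_diag_rotatedCov_le_div_effRank {S : Matrix (Fin D) (Fin D) ℝ}
    (hS : S.PosSemidef) :
    ∫ Q, cvSq (rotatedCov S Q).diag ∂haarOrth D ≤ 2 / effRank S := by
  have hsymm := Matrix.isHermitian_iff_isSymm.1 hS.isHermitian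
  refine (integral_cvSq_diag_rotatedCov_le hsymm).trans ?_
  rw [hsymm.eq, effRank, div_div_eq_mul_div]
  calc 2 * (S * S).trace / S.trace ^ 2
      ≤ 2 * (‖Matrix.toEuclideanCLM (n := Fin D) (𝕜 := ℝ) S‖ * S.trace) / S.trace ^ 2 := by
        gcongr; exact trace_mul_le_opNorm_mul_trace S hS
    _ = 2 * ‖Matrix.toEuclideanCLM (n := Fin D) (𝕜 := ℝ) S‖ / S.trace := by
        field_simp

end HaarMoments

/-! ### Concentration of the rotated standard deviations -/

section Concentration

variable {D : ℕ} {S : Matrix (Fin D) (Fin D) ℝ}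

lemma cvSq_rotatedStd_le (hS : S.PosSemidef) (Q : Orth D) :
    cvSq (rotatedStd S Q) ≤ cvSq (rotatedCov S Q).diag :=
  cvSq_sqrt_le fun _ => (posSemidef_rotatedCov hS Q).diag_nonneg

lemma mean_rotatedStd_pos (htr : 0 < S.trace) (Q : Orth D) : 0 < mean (rotatedStd S Q) := by
  have hD : 0 < D := by
    rcases D.eq_zero_or_pos with rfl | hD
    · simp [Matrix.trace] at htr
    · exact hD
  refine mean_sqrt_pos (x := (rotatedCov S Q).diag) ?_
  rw [mean, sum_diag_rotatedCov]
  positivity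

lemma trace_pos_of_effRank_pos (h : 0 < effRank S) : 0 < S.trace := by
  by_contra! hle
  exact h.not_ge (div_nonpos_of_nonpos_of_nonneg hle (norm_nonneg _))

lemma integrable_cvSq_diag_rotatedCov (S : Matrix (Fin D) (Fin D) ℝ) :
    Integrable (fun Q => cvSq (rotatedCov S Q).diag) (haarOrth D) := by
  simp only [cvSq_diag_rotatedCov]
  exact integrable_haarOrth (by fun_prop)

lemma haarOrth_le_cvSq_rotatedStd (hS : S.PosSemidef) {ε : ℝ} (hε : 0 < ε) :
    haarOrth D {Q | ε ≤ cvSq (rotatedStd S Q)} ≤ ENNReal.ofReal (2 / effRank S / ε) := by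
  have hmarkov := mul_meas_ge_le_integral_of_nonneg (.of_forall fun Q => cvSq_nonneg _)
    (integrable_cvSq_diag_rotatedCov S) ε
  have hmean := integral_cvSq_diag_rotatedCov_le_div_effRank hS
  rw [← ofReal_measureReal]
  refine ENNReal.ofReal_le_ofReal ((measureReal_mono fun Q hQ => ?_).trans
    ((le_div_iff₀' hε).2 (hmarkov.trans hmean)))
  exact hQ.trans (cvSq_rotatedStd_le hS Q)

end Concentration

section TendstoZeroInProb

variable {d : ℕ → ℕ}

lemma tendstoZeroInProb_cvSq_rotatedStd {S : ∀ k, Matrix (Fin (d k)) (Fin (d k)) ℝ}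
    (hS : ∀ k, (S k).PosSemidef) (hr : Tendsto (fun k => effRank (S k)) atTop atTop) :
    TendstoZeroInProb fun k Q => cvSq (rotatedStd (S k) Q) := by
  intro ε hε
  have hlim : Tendsto (fun k => ENNReal.ofReal (2 / effRank (S k) / ε)) atTop (𝓝 0) := by
    simpa using ENNReal.tendsto_ofReal ((hr.const_div_atTop 2).div_const ε)
  simp only [abs_of_nonneg (cvSq_nonneg _)]
  exact tendsto_of_tendsto_of_tendsto_of_le_of_le tendsto_const_nhds hlim (fun _ => zero_le)
    fun k => haarOrth_le_cvSq_rotatedStd (hS k) hε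

lemma eventually_mean_rotatedStd_pos {S : ∀ k, Matrix (Fin (d k)) (Fin (d k)) ℝ}
    (hr : Tendsto (fun k => effRank (S k)) atTop atTop) :
    ∀ᶠ k in atTop, ∀ Q, 0 < mean (rotatedStd (S k) Q) := by
  filter_upwards [hr.eventually_gt_atTop 0] with k hk Q
  exact mean_rotatedStd_pos (trace_pos_of_effRank_pos hk) Q

end TendstoZeroInProb

/-! ### Averages along families of small coefficient of variation -/

section LowCV

/-- The average of `φ` over the entries of `σ`, normalized to have mean `1`. -/
noncomputable def normAvg {D : ℕ} (φ : ℝ → ℝ) (σ : Fin D → ℝ) : ℝ :=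
  (∑ i, φ (σ i / mean σ)) / D

/-- The filter of vectors of positive mean whose coefficient of variation tends to `0`. The
dimension is part of the point, so that limits along `lowCV` are uniform in it. -/
noncomputable def lowCV : Filter (Σ D : ℕ, Fin D → ℝ) :=
  comap (fun p => cvSq p.2) (𝓝 0) ⊓ 𝓟 {p | 0 < mean p.2}

lemma eventually_mean_pos_lowCV : ∀ᶠ p in lowCV, 0 < mean p.2 :=
  mem_inf_of_right (mem_principal_self _)

lemma tendsto_cvSq_lowCV : Tendsto (fun p : Σ D : ℕ, Fin D → ℝ => cvSq p.2) lowCV (𝓝 0) :=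
  tendsto_comap.mono_left inf_le_left

lemma tendstoZeroInProb_of_tendsto_lowCV {d : ℕ → ℕ} {F : (Σ D : ℕ, Fin D → ℝ) → ℝ}
    (hF : Tendsto F lowCV (𝓝 0)) {σ : ∀ k, Orth (d k) → Fin (d k) → ℝ}
    (hm : ∀ᶠ k in atTop, ∀ Q, 0 < mean (σ k Q))
    (hcv : TendstoZeroInProb fun k Q => cvSq (σ k Q)) :
    TendstoZeroInProb fun k Q => F ⟨d k, σ k Q⟩ := by
  intro ε hε
  have hsmall := Metric.tendsto_nhds.1 hF ε hε
  rw [lowCV, eventually_inf_principal, eventually_comap] at hsmall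
  obtain ⟨δ, hδ, h⟩ := Metric.eventually_nhds_iff.1 hsmall
  refine tendsto_of_tendsto_of_tendsto_of_le_of_le' tendsto_const_nhds (hcv δ hδ)
    (.of_forall fun k => zero_le) ?_
  filter_upwards [hm] with k hk
  refine measure_mono fun Q (hQ : ε ≤ |F ⟨d k, σ k Q⟩|) => ?_
  by_contra hlt
  refine hQ.not_gt ?_
  simpa using h (by simpa using hlt) ⟨d k, σ k Q⟩ rfl (hk Q)

variable {D : ℕ} {σ : Fin D → ℝ}

lemma sum_eq_mul_normAvg (hm : 0 < mean σ) (φ : ℝ → ℝ) :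
    ∑ i, φ (σ i / mean σ) = D * normAvg φ σ := by
  have := dim_pos_of_mean_pos hm
  rw [normAvg]
  field_simp

lemma normAvg_const (hD : 0 < D) {m : ℝ} (hm : m ≠ 0) (φ : ℝ → ℝ) :
    normAvg φ (fun _ : Fin D => m) = φ 1 := by
  simp [normAvg, mean_const hD, div_self hm, hD.ne']

lemma cvSq_eq_normAvg (hm : mean σ ≠ 0) : cvSq σ = normAvg (fun u => (u - 1) ^ 2) σ := by
  have hterm (i : Fin D) : (σ i / mean σ - 1) ^ 2 = (σ i - mean σ) ^ 2 / mean σ ^ 2 := by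
    field_simp
  simp only [cvSq, normAvg, hterm, ← Finset.sum_div]
  rw [div_right_comm]

/-- Near `a` continuity gives the bound `ε`; at distance at least `δ` the quadratic growth of `φ`
is absorbed by `K * (u - a) ^ 2`. -/
lemma exists_abs_sub_le_add_mul_sq {φ : ℝ → ℝ} {a : ℝ} (hc : ContinuousAt φ a) {C : ℝ}
    (hb : ∀ u, |φ u| ≤ C * (1 + u ^ 2)) {ε : ℝ} (hε : 0 < ε) :
    ∃ K, ∀ u, |φ u - φ a| ≤ ε + K * (u - a) ^ 2 := by
  obtain ⟨δ, hδ, hnear⟩ := Metric.continuousAt_iff.1 hc ε hε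
  have hC : 0 ≤ C := by simpa using (abs_nonneg _).trans (hb 0)
  set M := C * (1 + 2 * a ^ 2) + |φ a| with hM
  have hK : 0 ≤ M / δ ^ 2 + 2 * C := by
    rw [hM]
    positivity
  refine ⟨M / δ ^ 2 + 2 * C, fun u => ?_⟩
  rcases lt_or_ge |u - a| δ with hu | hu
  · have hle : |φ u - φ a| ≤ ε := (hnear (x := u) hu).le
    exact hle.trans (le_add_of_nonneg_right (mul_nonneg hK (sq_nonneg _)))
  · have hfar : M ≤ M / δ ^ 2 * (u - a) ^ 2 := by
      rw [div_mul_eq_mul_div, le_div_iff₀ (by positivity), ← sq_abs (u - a)]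
      gcongr
    have hu_sq : u ^ 2 ≤ 2 * a ^ 2 + 2 * (u - a) ^ 2 := by nlinarith [sq_nonneg (u - 2 * a)]
    calc |φ u - φ a| ≤ |φ u| + |φ a| := abs_sub _ _
      _ ≤ C * (1 + u ^ 2) + |φ a| := by gcongr; exact hb u
      _ ≤ C * (1 + (2 * a ^ 2 + 2 * (u - a) ^ 2)) + |φ a| := by gcongr
      _ = M + 2 * C * (u - a) ^ 2 := by rw [hM]; ring
      _ ≤ ε + (M / δ ^ 2 + 2 * C) * (u - a) ^ 2 := by linarith

lemma abs_normAvg_sub_le (hm : 0 < mean σ) {φ : ℝ → ℝ} {ε K : ℝ}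
    (h : ∀ u, |φ u - φ 1| ≤ ε + K * (u - 1) ^ 2) : |normAvg φ σ - φ 1| ≤ ε + K * cvSq σ := by
  have hD : (0 : ℝ) < D := by exact_mod_cast dim_pos_of_mean_pos hm
  have hdiff : D * (normAvg φ σ - φ 1) = ∑ i, (φ (σ i / mean σ) - φ 1) := by
    simp [mul_sub, ← sum_eq_mul_normAvg hm]
  have hbound : ∑ i, (ε + K * (σ i / mean σ - 1) ^ 2) = D * (ε + K * cvSq σ) := by
    rw [cvSq_eq_normAvg hm.ne', mul_add, mul_left_comm, ← sum_eq_mul_normAvg hm]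
    simp [Finset.sum_add_distrib, Finset.mul_sum]
  refine le_of_mul_le_mul_left ?_ hD
  calc D * |normAvg φ σ - φ 1| = |∑ i, (φ (σ i / mean σ) - φ 1)| := by
        rw [← hdiff, abs_mul, abs_of_pos hD]
    _ ≤ ∑ i, |φ (σ i / mean σ) - φ 1| := Finset.abs_sum_le_sum_abs _ _
    _ ≤ ∑ i, (ε + K * (σ i / mean σ - 1) ^ 2) := Finset.sum_le_sum fun i _ => h _
    _ = D * (ε + K * cvSq σ) := hbound

lemma tendsto_normAvg {φ : ℝ → ℝ} (hc : ContinuousAt φ 1) {C : ℝ}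
    (hb : ∀ u, |φ u| ≤ C * (1 + u ^ 2)) :
    Tendsto (fun p : Σ D : ℕ, Fin D → ℝ => normAvg φ p.2) lowCV (𝓝 (φ 1)) := by
  rw [Metric.tendsto_nhds]
  intro ε hε
  obtain ⟨K, hK⟩ := exists_abs_sub_le_add_mul_sq hc hb (half_pos hε)
  have hcv : Tendsto (fun p : Σ D : ℕ, Fin D → ℝ => K * cvSq p.2) lowCV (𝓝 0) := by
    simpa using tendsto_cvSq_lowCV.const_mul K
  filter_upwards [hcv.eventually_lt_const (half_pos hε), eventually_mean_pos_lowCV] with p hp hm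
  calc |normAvg φ p.2 - φ 1| ≤ ε / 2 + K * cvSq p.2 := abs_normAvg_sub_le hm hK
    _ < ε := by linarith

end LowCV

/-! ### Coordinate scores in the per-coordinate model -/

section CoordScore

lemma covariance_sum_pi {ι : Type*} [Fintype ι] {Ω : ι → Type*} {mΩ : ∀ i, MeasurableSpace (Ω i)}
    {μ : ∀ i, Measure (Ω i)} [∀ i, IsProbabilityMeasure (μ i)] {X Y : ∀ i, Ω i → ℝ}
    (hX : ∀ i, MemLp (X i) 2 (μ i)) (hY : ∀ i, MemLp (Y i) 2 (μ i)) :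
    cov[fun ω => ∑ i, X i (ω i), fun ω => ∑ i, Y i (ω i); Measure.pi μ]
      = ∑ i, cov[X i, Y i; μ i] := by
  have heval (i : ι) : MeasurePreserving (Function.eval i) (Measure.pi μ) (μ i) :=
    measurePreserving_eval μ i
  have hXpi (i : ι) : MemLp (fun ω : ∀ i, Ω i => X i (ω i)) 2 (Measure.pi μ) :=
    (hX i).comp_measurePreserving (heval i)
  have hYpi (i : ι) : MemLp (fun ω : ∀ i, Ω i => Y i (ω i)) 2 (Measure.pi μ) :=
    (hY i).comp_measurePreserving (heval i)
  have hindep : iIndepFun (fun i (ω : ∀ i, Ω i) => ω i) (Measure.pi μ) :=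
    iIndepFun_pi (X := fun _ x => x) fun i => aemeasurable_id
  rw [covariance_fun_sum_fun_sum hXpi hYpi]
  refine Finset.sum_congr rfl fun i _ => ?_
  rw [Finset.sum_eq_single_of_mem i (Finset.mem_univ i)]
  · have hmap := (heval i).map_eq
    rw [← covariance_map_fun (Z := Function.eval i), hmap]
    · exact hmap ▸ (hX i).aestronglyMeasurable
    · exact hmap ▸ (hY i).aestronglyMeasurable
    · exact (heval i).aemeasurable
  · intro j _ hji
    refine IndepFun.covariance_eq_zero ?_ (hXpi i) (hYpi j)
    exact (hindep.indepFun hji.symm).comp₀ (heval i).aemeasurable (heval j).aemeasurable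
      ((heval i).map_eq ▸ (hX i).aemeasurable) ((heval j).map_eq ▸ (hY j).aemeasurable)

lemma integral_eq_zero_of_odd {G E : Type*} [MeasurableSpace G] [AddGroup G] [MeasurableNeg G]
    [NormedAddCommGroup E] [NormedSpace ℝ E] {μ : Measure G} [μ.IsNegInvariant] {f : G → E}
    (hf : Function.Odd f) : ∫ x, f x ∂μ = 0 := by
  have h := integral_neg_eq_self f μ
  simp only [hf _, integral_neg] at h
  have := IsAddTorsionFree.of_isTorsionFree ℝ E
  exact self_eq_neg.1 h.symm

instance (v : NNReal) : (gaussianReal 0 v).IsNegInvariant :=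
  ⟨gaussianReal_map_neg.trans (by rw [neg_zero])⟩

lemma memLp_id_two_gaussianReal (v : NNReal) : MemLp (fun x => x) 2 (gaussianReal 0 v) :=
  memLp_id_gaussianReal' 2 (by simp)

/-- The expectation of `h` under the centred Gaussian law of standard deviation `|u|`, written as
an integral against the standard Gaussian so that it depends on `u` through the integrand only. -/
noncomputable def gaussMoment (h : ℝ → ℝ) (u : ℝ) : ℝ := ∫ z, h (u * z) ∂gaussianReal 0 1

lemma integral_gaussianReal_toNNReal_sq {h : ℝ → ℝ} (hh : Measurable h) (s : ℝ) :
    ∫ z, h z ∂gaussianReal 0 (Real.toNNReal (s ^ 2)) = gaussMoment h s := by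
  have hmap := gaussianReal_map_const_mul (μ := 0) (v := 1) s
  rw [mul_zero, mul_one, ← Real.toNNReal_of_nonneg] at hmap
  rw [← hmap, integral_map (by fun_prop) hh.aestronglyMeasurable, gaussMoment]

lemma gaussMoment_comp_div (h : ℝ → ℝ) (c u : ℝ) :
    gaussMoment (fun x => h (x / c)) u = gaussMoment h (u / c) := by
  simp only [gaussMoment, div_mul_eq_mul_div]

lemma integral_sq_gaussianReal (v : NNReal) : ∫ z, z ^ 2 ∂gaussianReal 0 v = v := by
  have hvar := variance_fun_id_gaussianReal (μ := 0) (v := v)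
  rw [variance_eq_sub (memLp_id_two_gaussianReal v), integral_id_gaussianReal] at hvar
  simpa using hvar

lemma gaussMoment_sq (u : ℝ) : gaussMoment (fun x => x ^ 2) u = u ^ 2 := by
  simp [gaussMoment, mul_pow, integral_const_mul, integral_sq_gaussianReal]

/-- The score with uniform weights that applies `f` to every coordinate: `score1`, `score2 α` and
`score` are the coordinate scores of `Real.sign`, `twoBit α` and `id`. -/
def coordScore {D : ℕ} (f : ℝ → ℝ) (z : Fin D → ℝ) : ℝ := ∑ i, f (z i)

lemma measurable_coordScore {D : ℕ} {f : ℝ → ℝ} (hf : Measurable f) :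
    Measurable (coordScore f : (Fin D → ℝ) → ℝ) :=
  Finset.measurable_sum _ fun i _ => hf.comp (measurable_pi_apply i)

variable {D : ℕ} (σ : Fin D → ℝ) {f g : ℝ → ℝ}

lemma covariance_coordScore (hf : Measurable f) (hg : Measurable g) (hodd : Function.Odd f)
    (hf₂ : ∀ v, MemLp f 2 (gaussianReal 0 v)) (hg₂ : ∀ v, MemLp g 2 (gaussianReal 0 v)) :
    cov[coordScore f, coordScore g; model σ]
      = ∑ i, gaussMoment (fun x => f x * g x) (σ i) := by
  refine (covariance_sum_pi (fun _ => hf₂ _) fun _ => hg₂ _).trans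
    (Finset.sum_congr rfl fun i _ => ?_)
  rw [covariance_eq_sub (hf₂ _) (hg₂ _), integral_eq_zero_of_odd hodd, zero_mul, sub_zero]
  exact integral_gaussianReal_toNNReal_sq (hf.mul hg) (σ i)

lemma variance_coordScore (hf : Measurable f) (hodd : Function.Odd f)
    (hf₂ : ∀ v, MemLp f 2 (gaussianReal 0 v)) :
    Var[coordScore f; model σ] = ∑ i, gaussMoment (fun x => f x ^ 2) (σ i) := by
  rw [← covariance_self (measurable_coordScore hf).aemeasurable,
    covariance_coordScore σ hf hf hodd hf₂ hf₂]
  simp only [sq]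

lemma corr_coordScore_score (hf : Measurable f) (hodd : Function.Odd f)
    (hf₂ : ∀ v, MemLp f 2 (gaussianReal 0 v)) :
    corr (coordScore f) score (model σ)
      = (∑ i, gaussMoment (fun x => f x * x) (σ i))
        / √((∑ i, gaussMoment (fun x => f x ^ 2) (σ i)) * ∑ i, σ i ^ 2) := by
  have hscore : (score : (Fin D → ℝ) → ℝ) = coordScore fun x => x := rfl
  rw [corr, hscore, covariance_coordScore σ hf measurable_id' hodd hf₂ memLp_id_two_gaussianReal,
    variance_coordScore σ hf hodd hf₂,
    variance_coordScore σ measurable_id' (fun _ => rfl) memLp_id_two_gaussianReal]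
  simp only [gaussMoment_sq]

end CoordScore

section GaussMoment

variable {h : ℝ → ℝ} {C : ℝ}

lemma integrable_sq_gaussianReal : Integrable (fun z => z ^ 2) (gaussianReal 0 1) :=
  (memLp_id_two_gaussianReal 1).integrable_sq

lemma integrable_add_mul_sq_gaussianReal (a b : ℝ) :
    Integrable (fun z => a + b * z ^ 2) (gaussianReal 0 1) :=
  (integrable_const a).add (integrable_sq_gaussianReal.const_mul b)

lemma abs_gaussMoment_le (hb : ∀ x, |h x| ≤ C * (1 + x ^ 2)) (u : ℝ) :
    |gaussMoment h u| ≤ C * (1 + u ^ 2) := by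
  calc |gaussMoment h u| ≤ ∫ z, C * (1 + u ^ 2 * z ^ 2) ∂gaussianReal 0 1 := by
        rw [← Real.norm_eq_abs]
        refine norm_integral_le_of_norm_le
          ((integrable_add_mul_sq_gaussianReal 1 (u ^ 2)).const_mul C) (.of_forall fun z => ?_)
        simpa [mul_pow] using hb (u * z)
    _ = C * (1 + u ^ 2) := by
        rw [integral_const_mul, integral_add (integrable_const _)
          (integrable_sq_gaussianReal.const_mul _), integral_const_mul, integral_sq_gaussianReal]
        simp

lemma continuousAt_gaussMoment_one (hm : Measurable h) (hb : ∀ x, |h x| ≤ C * (1 + x ^ 2))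
    (hc : ∀ᵐ z ∂gaussianReal 0 1, ContinuousAt h z) : ContinuousAt (gaussMoment h) 1 := by
  have hC : 0 ≤ C := by simpa using (abs_nonneg _).trans (hb 0)
  refine continuousAt_of_dominated (bound := fun z => C * (1 + 2 ^ 2 * z ^ 2))
    (.of_forall fun u => (hm.comp (by fun_prop)).aestronglyMeasurable) ?_
    ((integrable_add_mul_sq_gaussianReal 1 (2 ^ 2)).const_mul C) ?_
  · have hnear : ∀ᶠ u : ℝ in 𝓝 1, |u| < 2 :=
      (continuous_abs.tendsto (1 : ℝ)).eventually_lt_const (by norm_num)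
    filter_upwards [hnear] with u hu
    refine .of_forall fun z => (hb (u * z)).trans ?_
    have hu_sq : u ^ 2 ≤ 2 ^ 2 := by
      rw [← sq_abs u]
      gcongr
    rw [mul_pow]
    gcongr
  · filter_upwards [hc] with z hz
    exact ContinuousAt.comp (f := fun u : ℝ => u * z) (by simpa using hz) (by fun_prop)

end GaussMoment

/-! ### Fidelity of a bounded odd quantizer -/

section Fidelity

/-- The fidelity of the score that applies the quantizer `g` to the coordinates measured in units of
the mean standard deviation. -/
noncomputable def fidelity {D : ℕ} (g : ℝ → ℝ) (σ : Fin D → ℝ) : ℝ :=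
  corr (coordScore fun x => g (x / mean σ)) score (model σ)

/-- The fidelity of the quantizer `g` when all standard deviations are equal, that is, the
correlation of `g Z` with `Z` for a standard Gaussian `Z`. -/
noncomputable def isoCorr (g : ℝ → ℝ) : ℝ :=
  gaussMoment (fun x => g x * x) 1 / √(gaussMoment (fun x => g x ^ 2) 1)

variable {g : ℝ → ℝ} {C : ℝ}

lemma fidelity_eq_normAvg {D : ℕ} {σ : Fin D → ℝ} (hm : 0 < mean σ) (hg : Measurable g)
    (hodd : Function.Odd g) (hb : ∀ x, |g x| ≤ C) :
    fidelity g σ = normAvg (gaussMoment fun x => g x * x) σ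
      / √(normAvg (gaussMoment fun x => g x ^ 2) σ * normAvg (fun u => u ^ 2) σ) := by
  have hD : (0 : ℝ) < D := by exact_mod_cast dim_pos_of_mean_pos hm
  have hcross (x : ℝ) : g (x / mean σ) * x = mean σ * (g (x / mean σ) * (x / mean σ)) := by
    field_simp
  have hcross_sum : ∑ i, gaussMoment (fun x => g (x / mean σ) * x) (σ i)
      = mean σ * D * normAvg (gaussMoment fun x => g x * x) σ := by
    have hterm (i : Fin D) : gaussMoment (fun x => g (x / mean σ) * x) (σ i)
        = mean σ * gaussMoment (fun x => g x * x) (σ i / mean σ) := by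
      simp only [hcross, ← gaussMoment_comp_div (fun x => g x * x)]
      simp only [gaussMoment, integral_const_mul]
    simp only [hterm, ← Finset.mul_sum, sum_eq_mul_normAvg hm, mul_assoc]
  have hsq_sum : ∑ i, σ i ^ 2 = mean σ ^ 2 * D * normAvg (fun u => u ^ 2) σ := by
    rw [mul_assoc, ← sum_eq_mul_normAvg hm, Finset.mul_sum]
    field_simp
  have hg' : Measurable fun x => g (x / mean σ) := by fun_prop
  rw [fidelity, corr_coordScore_score σ hg' (fun x => by rw [neg_div, hodd])
    (fun v => .of_bound hg'.aestronglyMeasurable C (.of_forall fun x => hb _)), hcross_sum, hsq_sum]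
  simp only [gaussMoment_comp_div (fun x => g x ^ 2), sum_eq_mul_normAvg hm]
  have hfactor (B V : ℝ) : D * B * (mean σ ^ 2 * D * V) = (mean σ * D) ^ 2 * (B * V) := by ring
  rw [hfactor, Real.sqrt_mul (by positivity), Real.sqrt_sq (by positivity),
    mul_div_mul_left _ _ (by positivity)]

lemma fidelity_const {D : ℕ} (hD : 0 < D) {m : ℝ} (hm : 0 < m) (hg : Measurable g)
    (hodd : Function.Odd g) (hb : ∀ x, |g x| ≤ C) :
    fidelity g (fun _ : Fin D => m) = isoCorr g := by
  rw [fidelity_eq_normAvg (by rwa [mean_const hD]) hg hodd hb]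
  simp only [normAvg_const hD hm.ne', one_pow, mul_one, isoCorr]

lemma tendsto_fidelity (hg : Measurable g) (hodd : Function.Odd g) (hb : ∀ x, |g x| ≤ C)
    (hc : ∀ᵐ z ∂gaussianReal 0 1, ContinuousAt g z)
    (hpos : 0 < gaussMoment (fun x => g x ^ 2) 1) :
    Tendsto (fun p : Σ D : ℕ, Fin D → ℝ => fidelity g p.2) lowCV (𝓝 (isoCorr g)) := by
  have hcross_le (x : ℝ) : |g x * x| ≤ C * (1 + x ^ 2) := by
    have hC : 0 ≤ C := (abs_nonneg _).trans (hb 0)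
    rw [abs_mul]
    gcongr
    · exact hb x
    · nlinarith [sq_nonneg (|x| - 1), sq_abs x]
  have hsq_le (x : ℝ) : |g x ^ 2| ≤ C ^ 2 * (1 + x ^ 2) := by
    rw [abs_pow]
    calc |g x| ^ 2 ≤ C ^ 2 := by gcongr; exact hb x
      _ ≤ C ^ 2 * (1 + x ^ 2) := le_mul_of_one_le_right (sq_nonneg C) (by nlinarith)
  have hcross := tendsto_normAvg (continuousAt_gaussMoment_one (by fun_prop) hcross_le
    (hc.mono fun z hz => hz.mul (continuousAt_id' z))) (abs_gaussMoment_le hcross_le)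
  have hsq := tendsto_normAvg (continuousAt_gaussMoment_one (by fun_prop) hsq_le
    (hc.mono fun z hz => hz.pow 2)) (abs_gaussMoment_le hsq_le)
  have hvar := tendsto_normAvg (φ := fun u => u ^ 2) (C := 1) (by fun_prop) fun u => by
    rw [abs_of_nonneg (sq_nonneg u)]
    linarith
  have hlim := hcross.div (hsq.mul hvar).sqrt (by simpa using (Real.sqrt_pos.2 hpos).ne')
  rw [one_pow, mul_one] at hlim
  refine hlim.congr' ?_
  filter_upwards [eventually_mean_pos_lowCV] with p hp
  exact (fidelity_eq_normAvg hp hg hodd hb).symm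

end Fidelity

/-! ### The quantizers -/

section Quantizers

/-- The two-bit quantizer with magnitude threshold `α`, so that
`score2 α = coordScore (twoBit α)`. -/
noncomputable def twoBit (α t : ℝ) : ℝ := (1 + magBit α t) * Real.sign t

lemma measurable_magBit (α : ℝ) : Measurable (magBit α) :=
  Measurable.ite (measurableSet_lt measurable_const measurable_abs) measurable_const
    measurable_const

lemma measurable_sign : Measurable Real.sign :=
  Measurable.ite measurableSet_Iio measurable_const
    (Measurable.ite measurableSet_Ioi measurable_const measurable_const)

lemma measurable_twoBit (α : ℝ) : Measurable (twoBit α) :=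
  (measurable_const.add (measurable_magBit α)).mul measurable_sign

lemma odd_sign : Function.Odd Real.sign := fun _ => Real.sign_neg

lemma odd_twoBit (α : ℝ) : Function.Odd (twoBit α) := fun x => by
  simp [twoBit, magBit, odd_sign x]

lemma abs_sign_le (x : ℝ) : |Real.sign x| ≤ 1 := by
  rcases Real.sign_apply_eq x with h | h | h <;> simp [h]

lemma sign_mul_self (x : ℝ) : Real.sign x * x = |x| := by
  rcases lt_trichotomy x 0 with h | rfl | h
  · rw [Real.sign_of_neg h, abs_of_neg h, neg_one_mul]
  · simp
  · rw [Real.sign_of_pos h, abs_of_pos h, one_mul]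

lemma sign_sq {x : ℝ} (hx : x ≠ 0) : Real.sign x ^ 2 = 1 := by
  rcases Real.sign_apply_eq_of_ne_zero x hx with h | h <;> simp [h]

lemma sign_div_of_pos {m : ℝ} (hm : 0 < m) (x : ℝ) : Real.sign (x / m) = Real.sign x := by
  rcases lt_trichotomy x 0 with h | rfl | h
  · rw [Real.sign_of_neg h, Real.sign_of_neg (div_neg_of_neg_of_pos h hm)]
  · rw [zero_div]
  · rw [Real.sign_of_pos h, Real.sign_of_pos (div_pos h hm)]

lemma magBit_nonneg (α t : ℝ) : 0 ≤ magBit α t := by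
  unfold magBit
  split_ifs <;> norm_num

lemma magBit_le_one (α t : ℝ) : magBit α t ≤ 1 := by
  unfold magBit
  split_ifs <;> norm_num

lemma abs_magBit_le (α t : ℝ) : |magBit α t| ≤ 1 := by
  rw [abs_of_nonneg (magBit_nonneg α t)]
  exact magBit_le_one α t

lemma magBit_sq (α t : ℝ) : magBit α t ^ 2 = magBit α t := by
  unfold magBit
  split_ifs <;> norm_num

lemma abs_twoBit_le (α x : ℝ) : |twoBit α x| ≤ 2 := by
  calc |twoBit α x| = |1 + magBit α x| * |Real.sign x| := abs_mul _ _
    _ ≤ (1 + 1) * 1 := by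
        gcongr
        · exact (abs_add_le _ _).trans (by simpa using abs_magBit_le α x)
        · exact abs_sign_le x
    _ = 2 := by norm_num

lemma twoBit_div_of_pos {m : ℝ} (hm : 0 < m) (α x : ℝ) :
    twoBit α (x / m) = twoBit (α * m) x := by
  simp only [twoBit, magBit, sign_div_of_pos hm, abs_div, abs_of_pos hm, lt_div_iff₀ hm]

lemma continuousAt_sign {z : ℝ} (hz : z ≠ 0) : ContinuousAt Real.sign z := by
  rcases hz.lt_or_gt with h | h
  · refine continuousAt_const.congr (f := fun _ => -1) ?_
    filter_upwards [eventually_lt_nhds h] with x hx using (Real.sign_of_neg hx).symm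
  · refine continuousAt_const.congr (f := fun _ => 1) ?_
    filter_upwards [eventually_gt_nhds h] with x hx using (Real.sign_of_pos hx).symm

lemma continuousAt_magBit {α z : ℝ} (hz : |z| ≠ α) : ContinuousAt (magBit α) z := by
  have habs : ContinuousAt (fun x : ℝ => |x|) z := continuous_abs.continuousAt
  rcases hz.lt_or_gt with h | h
  · refine continuousAt_const.congr (f := fun _ => 0) ?_
    filter_upwards [habs.eventually_lt_const h] with x hx using (if_neg hx.not_gt).symm
  · refine continuousAt_const.congr (f := fun _ => 1) ?_
    filter_upwards [habs.eventually_const_lt h] with x hx using (if_pos hx).symm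

lemma ae_ne_gaussianReal {v : NNReal} (hv : v ≠ 0) (a : ℝ) : ∀ᵐ z ∂gaussianReal 0 v, z ≠ a :=
  have := nullSingletonClass_gaussianReal (μ := 0) hv
  Measure.ae_ne _ a

lemma ae_continuousAt_sign : ∀ᵐ z ∂gaussianReal 0 1, ContinuousAt Real.sign z :=
  (ae_ne_gaussianReal one_ne_zero 0).mono fun _ => continuousAt_sign

lemma ae_continuousAt_twoBit (α : ℝ) : ∀ᵐ z ∂gaussianReal 0 1, ContinuousAt (twoBit α) z := by
  filter_upwards [ae_continuousAt_sign, ae_ne_gaussianReal one_ne_zero α,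
    ae_ne_gaussianReal one_ne_zero (-α)] with z hsign hα hnegα
  have habs : |z| ≠ α := fun h => (eq_or_eq_neg_of_abs_eq h).elim hα hnegα
  exact (continuousAt_const.add (continuousAt_magBit habs)).mul hsign

end Quantizers

/-! ### Gaussian integrals -/

section GaussianIntegrals

/-- The mean absolute value `√(2 / π)` of a standard Gaussian, which is the magnitude threshold for
unit standard deviations. -/
noncomputable def meanAbs : ℝ := √(2 / Real.pi)

lemma meanAbs_pos : 0 < meanAbs := Real.sqrt_pos.2 (by positivity)

lemma meanAbs_sq : meanAbs ^ 2 = 2 / Real.pi := Real.sq_sqrt (by positivity)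

lemma two_mul_gaussianPDFReal_zero_one (z : ℝ) :
    2 * gaussianPDFReal 0 1 z = meanAbs * Real.exp (-z ^ 2 / 2) := by
  have hconst : 2 * (√(2 * Real.pi))⁻¹ = meanAbs := by
    rw [meanAbs, Real.sqrt_mul zero_le_two, Real.sqrt_div zero_le_two]
    field_simp
    exact (Real.sq_sqrt zero_le_two).symm
  simp [gaussianPDFReal, ← hconst, mul_assoc]

lemma hasDerivAt_gaussianPDFReal (μ : ℝ) (v : NNReal) (x : ℝ) :
    HasDerivAt (gaussianPDFReal μ v) (-((x - μ) / v) * gaussianPDFReal μ v x) x := by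
  have hexponent : HasDerivAt (fun y : ℝ => -(y - μ) ^ 2 / (2 * v)) (-((x - μ) / v)) x := by
    convert! ((((hasDerivAt_id x).sub_const μ).pow 2).neg.div_const (2 * (v : ℝ))) using 1
    simp only [id_eq]
    ring
  convert! hexponent.exp.const_mul (√(2 * Real.pi * v))⁻¹ using 1
  rw [gaussianPDFReal]
  ring

lemma tendsto_gaussianPDFReal_atTop (μ : ℝ) {v : NNReal} (hv : v ≠ 0) :
    Tendsto (gaussianPDFReal μ v) atTop (𝓝 0) := by
  have hv' : (0 : ℝ) < 2 * v := by positivity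
  have hsub : Tendsto (fun x : ℝ => x - μ) atTop atTop :=
    tendsto_atTop_add_const_right _ (-μ) tendsto_id
  have hsq : Tendsto (fun x : ℝ => (x - μ) ^ 2 / (2 * v)) atTop atTop :=
    ((tendsto_pow_atTop two_ne_zero).comp hsub).atTop_div_const hv'
  have hexp := (Real.tendsto_exp_neg_atTop_nhds_zero.comp hsq).const_mul (√(2 * Real.pi * v))⁻¹
  simpa [Function.comp_def, gaussianPDFReal_def, neg_div] using hexp

lemma setIntegral_Ioi_mul_gaussianPDFReal {v : NNReal} (hv : v ≠ 0) {a : ℝ} (ha : 0 ≤ a) :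
    ∫ x in Set.Ioi a, x * gaussianPDFReal 0 v x = v * gaussianPDFReal 0 v a := by
  have hderiv (x : ℝ) : HasDerivAt (fun y => -(v * gaussianPDFReal 0 v y))
      (x * gaussianPDFReal 0 v x) x := by
    convert! ((hasDerivAt_gaussianPDFReal 0 v x).const_mul (v : ℝ)).neg using 1
    field_simp
    ring
  have hlim : Tendsto (fun y => -(v * gaussianPDFReal 0 v y)) atTop (𝓝 0) := by
    simpa using ((tendsto_gaussianPDFReal_atTop 0 hv).const_mul (v : ℝ)).neg
  rw [integral_Ioi_of_hasDerivAt_of_nonneg' (fun x _ => hderiv x)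
    (fun x hx => mul_nonneg (ha.trans hx.le) (gaussianPDFReal_nonneg 0 v x)) hlim]
  ring

lemma gaussianPDFReal_abs (v : NNReal) (x : ℝ) :
    gaussianPDFReal 0 v |x| = gaussianPDFReal 0 v x := by
  simp [gaussianPDFReal]

lemma integral_magBit_mul_abs {v : NNReal} (hv : v ≠ 0) {a : ℝ} (ha : 0 ≤ a) :
    ∫ z, magBit a z * |z| ∂gaussianReal 0 v = 2 * (v * gaussianPDFReal 0 v a) := by
  have hinter : Set.Ioi 0 ∩ Set.Ioi a = Set.Ioi a := by
    rw [Set.Ioi_inter_Ioi, sup_eq_right.2 ha]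
  calc ∫ z, magBit a z * |z| ∂gaussianReal 0 v
      = ∫ z, (Set.Ioi a).indicator (fun y => y * gaussianPDFReal 0 v y) |z| := by
        rw [integral_gaussianReal_eq_integral_smul hv]
        refine integral_congr_ae (.of_forall fun z => ?_)
        simp [magBit, Set.indicator_apply, gaussianPDFReal_abs, mul_comm]
    _ = 2 * ∫ y in Set.Ioi a, y * gaussianPDFReal 0 v y := by
        rw [integral_comp_abs, setIntegral_indicator measurableSet_Ioi, hinter]
    _ = 2 * (v * gaussianPDFReal 0 v a) := by rw [setIntegral_Ioi_mul_gaussianPDFReal hv ha]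

lemma integral_magBit_mul_abs_gaussianReal_one {a : ℝ} (ha : 0 ≤ a) :
    ∫ z, magBit a z * |z| ∂gaussianReal 0 1 = meanAbs * Real.exp (-a ^ 2 / 2) := by
  rw [integral_magBit_mul_abs one_ne_zero ha, NNReal.coe_one, one_mul,
    two_mul_gaussianPDFReal_zero_one]

lemma integral_abs_gaussianReal_one : ∫ z, |z| ∂gaussianReal 0 1 = meanAbs := by
  calc ∫ z, |z| ∂gaussianReal 0 1 = ∫ z, magBit 0 z * |z| ∂gaussianReal 0 1 := by
        refine integral_congr_ae ((ae_ne_gaussianReal one_ne_zero 0).mono fun z hz => ?_)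
        simp [magBit, hz]
    _ = meanAbs := by simp [integral_magBit_mul_abs_gaussianReal_one le_rfl]

lemma integrable_magBit (a : ℝ) {μ : Measure ℝ} [IsFiniteMeasure μ] : Integrable (magBit a) μ :=
  .of_bound (measurable_magBit a).aestronglyMeasurable 1 (.of_forall (abs_magBit_le a))

lemma two_mul_gaussianPDFReal_le_measureReal_Icc {v : NNReal} (hv : v ≠ 0) {a : ℝ} (ha : 0 ≤ a) :
    2 * a * gaussianPDFReal 0 v a ≤ (gaussianReal 0 v).real (Set.Icc (-a) a) := by
  have hle {x : ℝ} (hx : x ∈ Set.Icc (-a) a) : gaussianPDFReal 0 v a ≤ gaussianPDFReal 0 v x := by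
    have hsq : x ^ 2 ≤ a ^ 2 := sq_le_sq' hx.1 hx.2
    simp only [gaussianPDFReal, sub_zero]
    gcongr
  rw [measureReal_def, gaussianReal_apply_eq_integral 0 hv, ENNReal.toReal_ofReal
    (integral_nonneg fun x => gaussianPDFReal_nonneg 0 v x)]
  have hbound := setIntegral_ge_of_const_le_real (μ := volume) measurableSet_Icc
    measure_Icc_lt_top.ne (fun _ => hle) (integrable_gaussianPDFReal 0 v).integrableOn
  rw [Real.volume_real_Icc_of_le (by linarith)] at hbound
  linarith

lemma integral_magBit (a : ℝ) (μ : Measure ℝ) [IsProbabilityMeasure μ] :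
    ∫ z, magBit a z ∂μ = 1 - μ.real (Set.Icc (-a) a) := by
  have hind : magBit a = (Set.Icc (-a) a)ᶜ.indicator 1 := by
    ext z
    simp [magBit, Set.indicator_apply, ← abs_le]
  rw [hind, integral_indicator_one measurableSet_Icc.compl, probReal_compl_eq_one_sub
    measurableSet_Icc]

lemma integral_magBit_gaussianReal_one_le {a : ℝ} (ha : 0 ≤ a) :
    ∫ z, magBit a z ∂gaussianReal 0 1 ≤ 1 - a * meanAbs * Real.exp (-a ^ 2 / 2) := by
  rw [integral_magBit, mul_assoc, ← two_mul_gaussianPDFReal_zero_one]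
  linarith [two_mul_gaussianPDFReal_le_measureReal_Icc one_ne_zero ha]

end GaussianIntegrals

/-! ### The isotropic gain -/

section IsoAdvantage

lemma gaussMoment_sign_mul_self : gaussMoment (fun x => Real.sign x * x) 1 = meanAbs := by
  simp only [gaussMoment, one_mul, sign_mul_self, integral_abs_gaussianReal_one]

lemma gaussMoment_sign_sq : gaussMoment (fun x => Real.sign x ^ 2) 1 = 1 := by
  calc gaussMoment (fun x => Real.sign x ^ 2) 1 = ∫ _, 1 ∂gaussianReal 0 1 := by
        refine integral_congr_ae ((ae_ne_gaussianReal one_ne_zero 0).mono fun z hz => ?_)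
        simpa only [one_mul] using sign_sq hz
    _ = 1 := by simp

lemma gaussMoment_twoBit_mul_self {a : ℝ} (ha : 0 ≤ a) :
    gaussMoment (fun x => twoBit a x * x) 1 = meanAbs * (1 + Real.exp (-a ^ 2 / 2)) := by
  have habs : Integrable (fun z : ℝ => |z|) (gaussianReal 0 1) :=
    ((memLp_id_two_gaussianReal 1).integrable one_le_two).abs
  have hbit : Integrable (fun z : ℝ => magBit a z * |z|) (gaussianReal 0 1) :=
    habs.bdd_mul (measurable_magBit a).aestronglyMeasurable (.of_forall (abs_magBit_le a))
  have hsplit (z : ℝ) : twoBit a z * z = |z| + magBit a z * |z| := by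
    rw [twoBit, mul_assoc, sign_mul_self, add_mul, one_mul]
  simp only [gaussMoment, one_mul, hsplit]
  rw [integral_add habs hbit, integral_abs_gaussianReal_one,
    integral_magBit_mul_abs_gaussianReal_one ha, mul_add, mul_one]

lemma gaussMoment_twoBit_sq (a : ℝ) :
    gaussMoment (fun x => twoBit a x ^ 2) 1 = 1 + 3 * ∫ z, magBit a z ∂gaussianReal 0 1 := by
  calc gaussMoment (fun x => twoBit a x ^ 2) 1 = ∫ z, (1 + 3 * magBit a z) ∂gaussianReal 0 1 := by
        refine integral_congr_ae ((ae_ne_gaussianReal one_ne_zero 0).mono fun z hz => ?_)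
        simp only [one_mul, twoBit, mul_pow, sign_sq hz, mul_one]
        linarith [magBit_sq a z]
    _ = 1 + 3 * ∫ z, magBit a z ∂gaussianReal 0 1 := by
        rw [integral_add (integrable_const _) ((integrable_magBit a).const_mul 3),
          integral_const_mul]
        simp

lemma gaussMoment_twoBit_sq_pos (a : ℝ) : 0 < gaussMoment (fun x => twoBit a x ^ 2) 1 := by
  have htail : 0 ≤ ∫ z, magBit a z ∂gaussianReal 0 1 := integral_nonneg (magBit_nonneg a)
  rw [gaussMoment_twoBit_sq]
  positivity

/-- After division by `meanAbs` the claim is `1 + 3 P(|Z| > meanAbs) < (1 + e) ^ 2` with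
`e = exp (-1 / π)`; the tail is at most `1 - 2 e / π` and `e ≥ 1 - 1 / π`. -/
lemma isoCorr_sign_lt_isoCorr_twoBit : isoCorr Real.sign < isoCorr (twoBit meanAbs) := by
  have hexponent : -meanAbs ^ 2 / 2 = -Real.pi⁻¹ := by
    rw [meanAbs_sq]
    ring
  have htail := integral_magBit_gaussianReal_one_le meanAbs_pos.le
  have hcross := gaussMoment_twoBit_mul_self meanAbs_pos.le
  rw [hexponent] at htail hcross
  rw [← sq, meanAbs_sq, div_eq_mul_inv] at htail
  rw [isoCorr, isoCorr, gaussMoment_sign_mul_self, gaussMoment_sign_sq, hcross, Real.sqrt_one,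
    div_one, lt_div_iff₀ (Real.sqrt_pos.2 (gaussMoment_twoBit_sq_pos _))]
  refine mul_lt_mul_of_pos_left ?_ meanAbs_pos
  rw [Real.sqrt_lt' (by positivity), gaussMoment_twoBit_sq]
  have hexp : 1 - Real.pi⁻¹ ≤ Real.exp (-Real.pi⁻¹) := by
    linarith [Real.add_one_le_exp (-Real.pi⁻¹)]
  have hpi_lt : Real.pi⁻¹ < 0.32 := by
    rw [inv_lt_comm₀ Real.pi_pos (by norm_num)]
    linarith [Real.pi_gt_d2]
  have hpi_gt : 0.317 < Real.pi⁻¹ := by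
    rw [lt_inv_comm₀ (by norm_num) Real.pi_pos]
    linarith [Real.pi_lt_d2]
  nlinarith

/-- The universal value `Δ₀` of the isotropic gain. -/
noncomputable def isoAdvantage : ℝ := isoCorr (twoBit meanAbs) - isoCorr Real.sign

lemma isoAdvantage_pos : 0 < isoAdvantage := sub_pos.2 isoCorr_sign_lt_isoCorr_twoBit

variable {D : ℕ} {σ : Fin D → ℝ}

lemma rho1_eq_fidelity (hm : 0 < mean σ) : rho1 σ = fidelity Real.sign σ := by
  simp only [fidelity, sign_div_of_pos hm]
  rfl

lemma rho2_eq_fidelity (hm : 0 < mean σ) : rho2 σ = fidelity (twoBit meanAbs) σ := by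
  simp only [fidelity, twoBit_div_of_pos hm]
  rfl

lemma isoGain_eq_isoAdvantage (hm : 0 < mean σ) : isoGain σ = isoAdvantage := by
  have hD := dim_pos_of_mean_pos hm
  have hm' : 0 < mean fun _ : Fin D => mean σ := by rwa [mean_const hD]
  rw [isoGain, rho1_eq_fidelity hm', rho2_eq_fidelity hm', isoAdvantage,
    fidelity_const hD hm (measurable_twoBit _) (odd_twoBit _) (abs_twoBit_le _),
    fidelity_const hD hm measurable_sign odd_sign abs_sign_le]

lemma tendsto_advantage : Tendsto (fun p : Σ D : ℕ, Fin D → ℝ => advantage p.2) lowCV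
    (𝓝 isoAdvantage) := by
  have hone := tendsto_fidelity measurable_sign odd_sign abs_sign_le ae_continuousAt_sign
    (by simp only [gaussMoment_sign_sq, one_pos])
  have htwo := tendsto_fidelity (measurable_twoBit meanAbs) (odd_twoBit _) (abs_twoBit_le _)
    (ae_continuousAt_twoBit _) (gaussMoment_twoBit_sq_pos _)
  refine (htwo.sub hone).congr' ?_
  filter_upwards [eventually_mean_pos_lowCV] with p hp
  rw [advantage, rho1_eq_fidelity hp, rho2_eq_fidelity hp]

lemma tendsto_hetGain : Tendsto (fun p : Σ D : ℕ, Fin D → ℝ => hetGain p.2) lowCV (𝓝 0) := by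
  rw [← sub_self isoAdvantage]
  refine (tendsto_advantage.sub_const isoAdvantage).congr' ?_
  filter_upwards [eventually_mean_pos_lowCV] with p hp
  rw [hetGain, isoGain_eq_isoAdvantage hp]

end IsoAdvantage

end BQ

theorem mainTheorem4 :
    ∃ Δ₀ : ℝ, 0 < Δ₀ ∧
      (∀ (D : ℕ) (σ : Fin D → ℝ), 0 < BQ.mean σ → BQ.isoGain σ = Δ₀) ∧
      ∀ (d : ℕ → ℕ) (S : ∀ k, Matrix (Fin (d k)) (Fin (d k)) ℝ),
        (∀ k, (S k).PosSemidef) →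
        Tendsto (fun k => BQ.effRank (S k)) atTop atTop →
        BQ.TendstoZeroInProb (fun k Q => BQ.cvSq (BQ.rotatedStd (S k) Q)) ∧
        BQ.TendstoZeroInProb (fun k Q => BQ.hetGain (BQ.rotatedStd (S k) Q)) ∧
        BQ.TendstoZeroInProb (fun k Q => BQ.advantage (BQ.rotatedStd (S k) Q) - Δ₀) := by
  refine ⟨BQ.isoAdvantage, BQ.isoAdvantage_pos, fun D σ => BQ.isoGain_eq_isoAdvantage,
    fun d S hS hr => ?_⟩
  have hmean := BQ.eventually_mean_rotatedStd_pos hr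
  have hcv := BQ.tendstoZeroInProb_cvSq_rotatedStd hS hr
  have hadv : Tendsto (fun p : Σ D : ℕ, Fin D → ℝ => BQ.advantage p.2 - BQ.isoAdvantage)
      BQ.lowCV (𝓝 0) := by
    simpa using BQ.tendsto_advantage.sub_const BQ.isoAdvantage
  exact ⟨hcv, BQ.tendstoZeroInProb_of_tendsto_lowCV BQ.tendsto_hetGain hmean hcv,
    BQ.tendstoZeroInProb_of_tendsto_lowCV hadv hmean hcv⟩
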